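/- Let $K$ be a field of characteristic different from $2$ and let $X$ be a partially ordered set which is connected, i.e. any two elements of $X$ are joined by a finite sequence in which consecutive elements are comparable. *Notation.* $I(X,K)$ is the $K$-vector space of functions $f:X\times X\to K$ with $f(x,y)=0$ whenever $x\nleq y$. The finitary incidence algebra $FI(X,K)$ is the subspace of those $f\in I(X,K)$ such that for all $x\le y$ there are only finitely many subintervals $[u,v]\subseteq[x,y]$ with $u\ne v$ and $f(u,v)\neq 0$; it is a $K$-algebra under the product $(fg)(x,y)=\sum_{x\le z\le y}f(x,z)g(z,y)$. For $x\in X$, $e_x\in FI(X,K)$ has value $1$ at $(x,x)$ and $0$ elsewhere. For an (order) automorphism $\alpha$ of $X$, $\widehat\alpha$ is the automorphism of $FI(X,K)$ given by $\widehat\alpha(f)(x,y)=f(\alpha^{-1}(x),\alpha^{-1}(y))$. A $K$-algebra automorphism of $FI(X,K)$ is *multiplicative* if it has the form $f\mapsto\big((x,y)\mapsto\sigma(x,y)f(x,y)\big)$ for some $\sigma\in I(X,K)$ with $\sigma(x,y)\ne0$ for $x\le y$ and $\sigma(x,y)\sigma(y,z)=\sigma(x,z)$ for $x\le y\le z$;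 it is *inner* if it is conjugation by an invertible element. An *involution* on a $K$-algebra $A$ is an additive map $\rho:A\to A$ with $\rho(ab)=\rho(b)\rho(a)$ and $\rho(\rho(a))=a$; it is of the *second kind* if it is not the identity on the center of $A$. (This applies in particular to $A=K$.) Two involutions $\rho_1,\rho_2$ on $A$ are *equivalent* if $\Phi\circ\rho_1=\rho_2\circ\Phi$ for some $K$-algebra automorphism $\Phi$ of $A$. An *involution* on $X$ is a map $\lambda:X\to X$ with $\lambda(\lambda(x))=x$ and $x\le y\Leftrightarrow\lambda(y)\le\lambda(x)$; two involutions $\lambda,\mu$ on $X$ are *equivalent* if $\alpha\circ\lambda=\mu\circ\alpha$ for some automorphism $\alpha$ of $X$. An involution $\rho$ on $FI(X,K)$ *induces* $\lambda:X\to X$ if $\rho(e_x)$ is conjugate (by an invertible element of $FI(X,K)$) to $e_{\lambda(x)}$ for every $x\in X$, and *induces* $\ast:K\to K$ if $\rho(k\cdot 1)=k^{\ast}\cdot 1$ for all $k\in K$, i.e. $\rho|_K=\ast$. *Statement.* Assume that every multiplicative automorphism of $FI(X,K)$ is inner. (i) Let $\rho_1,\rho_2$ be equivalent involutions of the second kind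 on $FI(X,K)$. Then each $\rho_i$ induces exactly one map $\lambda_i$ on $X$, the maps $\lambda_1,\lambda_2$ are involutions on $X$, and $\lambda_1$ and $\lambda_2$ are equivalent. Moreover $\rho_1$ and $\rho_2$ restrict to one and the same map on $K$, $\rho_1|_K=\rho_2|_K$, which is an involution of the second kind on $K$. (ii) Let $\lambda_1,\lambda_2$ be involutions on $X$, let $\alpha$ be an automorphism of $X$ with $\alpha\circ\lambda_2=\lambda_1\circ\alpha$, and let $\ast$ be an involution of the second kind on $K$. If $\rho$ is an involution on $FI(X,K)$ that induces $\lambda_2$ on $X$ and $\ast$ on $K$, then $\widehat\alpha\circ\rho\circ\widehat\alpha^{-1}$ is an involution on $FI(X,K)$, it is equivalent to $\rho$, and it induces $\lambda_1$ on $X$ and $\ast$ on $K$. -/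

import Mathlib

/-! ### Involutions on algebras -/

/-- An involution on a ring (in particular on a `K`-algebra) `A`: an additive,
anti-multiplicative map whose square is the identity. It need not be `K`-linear. -/
structure IsInvolution {A : Type*} [Ring A] (ρ : A → A) : Prop where
  map_add : ∀ a b, ρ (a + b) = ρ a + ρ b
  map_mul : ∀ a b, ρ (a * b) = ρ b * ρ a
  involutive : ∀ a, ρ (ρ a) = a

/-- An involution of the second kind: it is not the identity map on the center. -/
def IsInvolutionOfSecondKind {A : Type*} [Ring A] (ρ : A → A) : Prop :=
  IsInvolution ρ ∧ ∃ a ∈ Subring.center A, ρ a ≠ a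

/-- Two involutions are equivalent if they are intertwined by a `K`-algebra automorphism. -/
def EquivalentInvolutions (K : Type*) {A : Type*} [Field K] [Ring A] [Algebra K A]
    (ρ₁ ρ₂ : A → A) : Prop :=
  ∃ Φ : A ≃ₐ[K] A, ⇑Φ ∘ ρ₁ = ρ₂ ∘ ⇑Φ

/-- An automorphism is inner if it is conjugation by an invertible element. -/
def IsInnerAut {K A : Type*} [Field K] [Ring A] [Algebra K A] (Φ : A ≃ₐ[K] A) : Prop :=
  ∃ u : Aˣ, ∀ a, Φ a = u * a * (u⁻¹ : Aˣ)

/-- The map `ρ` on the `K`-algebra `A` restricts to the map `s` on (the image in `A` of) `K`. -/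
def InducesOnField {K A : Type*} [Field K] [Ring A] [Algebra K A]
    (ρ : A → A) (s : K → K) : Prop :=
  ∀ k : K, ρ (algebraMap K A k) = algebraMap K A (s k)

/-! ### Posets -/

/-- An involution on a poset: an order-reversing self-inverse map. -/
structure IsPosetInvolution {X : Type*} [PartialOrder X] (l : X → X) : Prop where
  involutive : ∀ x, l (l x) = x
  le_iff : ∀ x y, x ≤ y ↔ l y ≤ l x

/-- Two involutions on a poset are equivalent if they are intertwined by an automorphism. -/
def EquivalentPosetInvolutions {X : Type*} [PartialOrder X] (l₁ l₂ : X → X) : Prop :=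
  ∃ α : X ≃o X, ⇑α ∘ l₁ = l₂ ∘ ⇑α

/-- A poset is connected if any two elements are joined by a finite sequence of elements in
which consecutive ones are comparable. -/
def IsConnectedPoset (X : Type*) [PartialOrder X] : Prop :=
  ∀ x y : X, Relation.TransGen (fun a b : X => a ≤ b ∨ b ≤ a) x y

/-! ### The finitary incidence algebra

`IncidenceAlgebra K X` is Mathlib's space of functions `f : X → X → K` with `f x y = 0` unless
`x ≤ y`, that is, the incidence space `I(X,K)` (no local finiteness is needed for its `K`-vector
space structure). -/

/-- The subspace of those `f` in `I(X,K)` such that every interval `[x, y]` has only finitely many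
subintervals `[u, v]` with `u ≠ v` and `f u v ≠ 0`. -/
def finitarySubmodule (K X : Type*) [Field K] [PartialOrder X] :
    Submodule K (IncidenceAlgebra K X) where
  carrier := {f | ∀ x y : X, x ≤ y →
    {p : X × X | x ≤ p.1 ∧ p.1 ≤ p.2 ∧ p.2 ≤ y ∧ p.1 ≠ p.2 ∧ f p.1 p.2 ≠ 0}.Finite}
  zero_mem' := by
    intro x y _
    simp
  add_mem' := by
    intro f g hf hg x y hxy
    refine ((hf x y hxy).union (hg x y hxy)).subset ?_
    rintro p ⟨h1, h2, h3, h4, h5⟩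
    by_cases h : f p.1 p.2 = 0
    · refine Or.inr ⟨h1, h2, h3, h4, ?_⟩
      intro h'
      exact h5 (by simp [h, h'])
    · exact Or.inl ⟨h1, h2, h3, h4, h⟩
  smul_mem' := by
    intro c f hf x y hxy
    refine (hf x y hxy).subset ?_
    rintro p ⟨h1, h2, h3, h4, h5⟩
    refine ⟨h1, h2, h3, h4, ?_⟩
    intro h'
    exact h5 (by simp [h', IncidenceAlgebra.constSMul_apply])

/-- The finitary incidence algebra `FI(X,K)`. -/
def FI (K X : Type*) [Field K] [PartialOrder X] : Type _ := ↥(finitarySubmodule K X)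

namespace FI

variable {K X : Type*} [Field K] [PartialOrder X]

noncomputable instance : AddCommGroup (FI K X) :=
  inferInstanceAs (AddCommGroup ↥(finitarySubmodule K X))

noncomputable instance : Module K (FI K X) :=
  inferInstanceAs (Module K ↥(finitarySubmodule K X))

instance : FunLike (FI K X) X (X → K) where
  coe f := ⇑f.1
  coe_injective _ _ h := Subtype.ext (DFunLike.coe_injective h)

/-- Constructor of an element of `FI(X,K)` from a function of two variables. -/
def mk (f : X → X → K) (h₀ : ∀ x y, ¬ x ≤ y → f x y = 0)
    (h₁ : ∀ x y : X, x ≤ y →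
      {p : X × X | x ≤ p.1 ∧ p.1 ≤ p.2 ∧ p.2 ≤ y ∧ p.1 ≠ p.2 ∧ f p.1 p.2 ≠ 0}.Finite) :
    FI K X :=
  ⟨⟨f, fun x y h => h₀ x y h⟩, h₁⟩

theorem mk_apply (f : X → X → K) (h₀) (h₁) (x y : X) : (mk f h₀ h₁ : FI K X) x y = f x y := rfl

theorem ext' {f g : FI K X} (h : ∀ x y, f x y = g x y) : f = g :=
  DFunLike.coe_injective (funext fun x => funext fun y => h x y)

theorem add_apply (f g : FI K X) (x y : X) : (f + g) x y = f x y + g x y := rfl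
theorem zero_apply (x y : X) : (0 : FI K X) x y = 0 := rfl
theorem smul_apply (c : K) (f : FI K X) (x y : X) : (c • f) x y = c * f x y := rfl

theorem apply_eq_zero (f : FI K X) {x y : X} (h : ¬ x ≤ y) : f x y = 0 :=
  f.1.eq_zero_of_not_le' h

theorem le_of_ne (f : FI K X) {x y : X} (h : f x y ≠ 0) : x ≤ y := by
  by_contra h'
  exact h (f.apply_eq_zero h')

theorem finite_intervals (f : FI K X) (x y : X) :
    {p : X × X | x ≤ p.1 ∧ p.1 ≤ p.2 ∧ p.2 ≤ y ∧ p.1 ≠ p.2 ∧ f p.1 p.2 ≠ 0}.Finite := by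
  by_cases hxy : x ≤ y
  · exact f.2 x y hxy
  · refine Set.finite_empty.subset ?_
    rintro p ⟨h1, h2, h3, -⟩
    exact hxy (h1.trans (h2.trans h3))

theorem finite_left (f : FI K X) (x y : X) : {z | z ≤ y ∧ f x z ≠ 0}.Finite := by
  refine (((f.finite_intervals x y).image Prod.snd).union (Set.finite_singleton x)).subset ?_
  rintro z ⟨h1, h2⟩
  by_cases h : x = z
  · exact Or.inr h.symm
  · exact Or.inl ⟨(x, z), ⟨le_rfl, f.le_of_ne h2, h1, h, h2⟩, rfl⟩

theorem finite_right (f : FI K X) (x y : X) : {z | x ≤ z ∧ f z y ≠ 0}.Finite := by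
  refine (((f.finite_intervals x y).image Prod.fst).union (Set.finite_singleton y)).subset ?_
  rintro z ⟨h1, h2⟩
  by_cases h : z = y
  · exact Or.inr h
  · exact Or.inl ⟨(z, y), ⟨h1, f.le_of_ne h2, le_rfl, h, h2⟩, rfl⟩

/-- The convolution product: `(f * g) x y` is the sum of `f x z * g z y` over `x ≤ z ≤ y`
(only finitely many terms are nonzero). -/
noncomputable instance : Mul (FI K X) where
  mul f g := mk (fun x y => ∑ᶠ z ∈ Set.Icc x y, f x z * g z y)
    (by
      intro x y h
      simp [Set.Icc_eq_empty h])
    (by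
      intro x y _
      refine ((((f.finite_intervals x y).image Prod.fst).union
        ((g.finite_intervals x y).image Prod.fst)).prod
        (((f.finite_intervals x y).image Prod.snd).union
        ((g.finite_intervals x y).image Prod.snd))).subset ?_
      rintro ⟨u, v⟩ ⟨h1, h2, h3, h4, h5⟩
      obtain ⟨z, hz⟩ : ∃ z, z ∈ Set.Icc u v ∧ f u z * g z v ≠ 0 := by
        by_contra! hcon
        exact h5 (finsum_mem_eq_zero_of_forall_eq_zero hcon)
      obtain ⟨⟨huz, hzv⟩, hne⟩ := hz
      have hf : f u z ≠ 0 := left_ne_zero_of_mul hne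
      have hg : g z v ≠ 0 := right_ne_zero_of_mul hne
      simp only at h1 h2 h3 h4
      constructor
      · by_cases h : u = z
        · subst h
          exact Or.inr ⟨(u, v), ⟨h1, hzv, h3, h4, hg⟩, rfl⟩
        · exact Or.inl ⟨(u, z), ⟨h1, huz, hzv.trans h3, h, hf⟩, rfl⟩
      · by_cases h : z = v
        · subst h
          exact Or.inl ⟨(u, z), ⟨h1, huz, h3, h4, hf⟩, rfl⟩
        · exact Or.inr ⟨(z, v), ⟨h1.trans huz, hzv, h3, h, hg⟩, rfl⟩)

theorem mul_apply (f g : FI K X) (x y : X) :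
    (f * g) x y = ∑ᶠ z ∈ Set.Icc x y, f x z * g z y := rfl

theorem mul_apply_of_left (f g : FI K X) (x y : X) (S : Finset X)
    (hS : ∀ z, z ≤ y → f x z ≠ 0 → z ∈ S) :
    (f * g) x y = ∑ z ∈ S, f x z * g z y := by
  have h : ∀ z, z ∉ Set.Icc x y → f x z * g z y = 0 := by
    intro z hz
    by_contra hne
    exact hz ⟨f.le_of_ne (left_ne_zero_of_mul hne), g.le_of_ne (right_ne_zero_of_mul hne)⟩
  rw [mul_apply, finsum_mem_eq_sum_of_inter_support_eq]
  ext z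
  simp only [Set.mem_inter_iff, Function.mem_support, Finset.mem_coe]
  constructor
  · rintro ⟨h1, h2⟩
    exact ⟨hS z h1.2 (left_ne_zero_of_mul h2), h2⟩
  · rintro ⟨-, h2⟩
    refine ⟨?_, h2⟩
    by_contra h3
    exact h2 (h z h3)

theorem mul_apply_of_right (f g : FI K X) (x y : X) (S : Finset X)
    (hS : ∀ z, x ≤ z → g z y ≠ 0 → z ∈ S) :
    (f * g) x y = ∑ z ∈ S, f x z * g z y := by
  have h : ∀ z, z ∉ Set.Icc x y → f x z * g z y = 0 := by
    intro z hz
    by_contra hne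
    exact hz ⟨f.le_of_ne (left_ne_zero_of_mul hne), g.le_of_ne (right_ne_zero_of_mul hne)⟩
  rw [mul_apply, finsum_mem_eq_sum_of_inter_support_eq]
  ext z
  simp only [Set.mem_inter_iff, Function.mem_support, Finset.mem_coe]
  constructor
  · rintro ⟨h1, h2⟩
    exact ⟨hS z h1.1 (right_ne_zero_of_mul h2), h2⟩
  · rintro ⟨-, h2⟩
    refine ⟨?_, h2⟩
    by_contra h3
    exact h2 (h z h3)

/-- The diagonal element with diagonal entries `d`. -/
noncomputable def diag (d : X → K) : FI K X :=
  mk (open Classical in fun x y => if x = y then d x else 0)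
    (by
      intro x y h
      exact if_neg fun e => h e.le)
    (by
      intro x y _
      refine Set.finite_empty.subset ?_
      rintro p ⟨-, -, -, h4, h5⟩
      exact h5 (if_neg h4))

theorem diag_apply_self (d : X → K) (x : X) : (diag d : FI K X) x x = d x := if_pos rfl

theorem diag_apply_ne (d : X → K) {x y : X} (h : x ≠ y) : (diag d : FI K X) x y = 0 := if_neg h

theorem diag_mul_apply (d : X → K) (f : FI K X) (x y : X) :
    (diag d * f) x y = d x * f x y := by
  rw [mul_apply_of_left (diag d) f x y {x}]
  · simp [diag_apply_self]
  · intro z _ hz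
    by_contra hne
    refine hz (diag_apply_ne d fun e => hne ?_)
    simp [e]

theorem mul_diag_apply (d : X → K) (f : FI K X) (x y : X) :
    (f * diag d) x y = f x y * d y := by
  rw [mul_apply_of_right f (diag d) x y {y}]
  · simp [diag_apply_self]
  · intro z _ hz
    by_contra hne
    refine hz (diag_apply_ne d fun e => hne ?_)
    simp [e]

theorem mul_assoc' (f g h : FI K X) : f * g * h = f * (g * h) := by
  refine ext' fun x y => ?_
  rw [mul_apply_of_right (f * g) h x y (h.finite_right x y).toFinset
      (fun z h1 h2 => by simpa using ⟨h1, h2⟩),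
    mul_apply_of_left f (g * h) x y (f.finite_left x y).toFinset
      (fun z h1 h2 => by simpa using ⟨h1, h2⟩)]
  have e1 : ∀ z ∈ (h.finite_right x y).toFinset, (f * g) x z * h z y =
      ∑ w ∈ (f.finite_left x y).toFinset, f x w * g w z * h z y := by
    intro z hz
    have hz' : x ≤ z ∧ h z y ≠ 0 := by simpa using hz
    rw [mul_apply_of_left f g x z (f.finite_left x y).toFinset
      (fun w h1 h2 => by simpa using ⟨h1.trans (h.le_of_ne hz'.2), h2⟩), Finset.sum_mul]
  have e2 : ∀ w ∈ (f.finite_left x y).toFinset, f x w * (g * h) w y =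
      ∑ z ∈ (h.finite_right x y).toFinset, f x w * g w z * h z y := by
    intro w hw
    have hw' : w ≤ y ∧ f x w ≠ 0 := by simpa using hw
    rw [mul_apply_of_right g h w y (h.finite_right x y).toFinset
      (fun z h1 h2 => by simpa using ⟨(f.le_of_ne hw'.2).trans h1, h2⟩), Finset.mul_sum]
    exact Finset.sum_congr rfl fun z _ => (mul_assoc _ _ _).symm
  rw [Finset.sum_congr rfl e1, Finset.sum_congr rfl e2, Finset.sum_comm]

/-- `FI(X,K)` is a ring; its unity is the function that is `1` on the diagonal and `0` off it. -/
noncomputable instance : Ring (FI K X) where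
  __ := (inferInstance : AddCommGroup (FI K X))
  one := diag fun _ => 1
  one_mul f := ext' fun x y => (diag_mul_apply _ f x y).trans (one_mul _)
  mul_one f := ext' fun x y => (mul_diag_apply _ f x y).trans (mul_one _)
  mul_assoc := mul_assoc'
  zero_mul f := ext' fun x y => by
    rw [mul_apply_of_left 0 f x y ∅ (fun z _ h => absurd (zero_apply x z) h)]
    simp [zero_apply]
  mul_zero f := ext' fun x y => by
    rw [mul_apply_of_right f 0 x y ∅ (fun z _ h => absurd (zero_apply z y) h)]
    simp [zero_apply]
  left_distrib f g h := ext' fun x y => by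
    have hS : ∀ z, z ≤ y → f x z ≠ 0 → z ∈ (f.finite_left x y).toFinset :=
      fun z h1 h2 => by simpa using ⟨h1, h2⟩
    rw [add_apply, mul_apply_of_left f (g + h) x y _ hS, mul_apply_of_left f g x y _ hS,
      mul_apply_of_left f h x y _ hS, ← Finset.sum_add_distrib]
    exact Finset.sum_congr rfl fun z _ => by rw [add_apply, mul_add]
  right_distrib f g h := ext' fun x y => by
    have hS : ∀ z, x ≤ z → h z y ≠ 0 → z ∈ (h.finite_right x y).toFinset :=
      fun z h1 h2 => by simpa using ⟨h1, h2⟩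
    rw [add_apply, mul_apply_of_right (f + g) h x y _ hS, mul_apply_of_right f h x y _ hS,
      mul_apply_of_right g h x y _ hS, ← Finset.sum_add_distrib]
    exact Finset.sum_congr rfl fun z _ => by rw [add_apply, add_mul]

noncomputable instance : Algebra K (FI K X) :=
  Algebra.ofModule
    (fun c f g => ext' fun x y => by
      have hS : ∀ z, x ≤ z → g z y ≠ 0 → z ∈ (g.finite_right x y).toFinset :=
        fun z h1 h2 => by simpa using ⟨h1, h2⟩
      rw [smul_apply, mul_apply_of_right _ g x y _ hS, mul_apply_of_right f g x y _ hS,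
        Finset.mul_sum]
      exact Finset.sum_congr rfl fun z _ => by rw [smul_apply, mul_assoc])
    (fun c f g => ext' fun x y => by
      have hS : ∀ z, z ≤ y → f x z ≠ 0 → z ∈ (f.finite_left x y).toFinset :=
        fun z h1 h2 => by simpa using ⟨h1, h2⟩
      rw [smul_apply, mul_apply_of_left f _ x y _ hS, mul_apply_of_left f g x y _ hS,
        Finset.mul_sum]
      exact Finset.sum_congr rfl fun z _ => by rw [smul_apply, mul_left_comm])

/-- The idempotent `e_x`: its value is `1` at `(x, x)` and `0` elsewhere. -/
noncomputable def e (K : Type*) {X : Type*} [Field K] [PartialOrder X] (x : X) : FI K X :=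
  diag (open Classical in fun y => if y = x then 1 else 0)

/-- The map `f ↦ f (α⁻¹ x, α⁻¹ y)` on `FI(X,K)`, for an automorphism `α` of `X`. -/
def hatFun (K : Type*) {X : Type*} [Field K] [PartialOrder X] (α : X ≃o X) (f : FI K X) :
    FI K X :=
  mk (fun x y => f (α.symm x) (α.symm y))
    (fun x y h => f.apply_eq_zero fun h' => h (α.symm.le_iff_le.mp h'))
    (by
      intro x y _
      refine ((f.finite_intervals (α.symm x) (α.symm y)).image (Prod.map α α)).subset ?_
      rintro ⟨u, v⟩ ⟨h1, h2, h3, h4, h5⟩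
      refine ⟨(α.symm u, α.symm v), ⟨α.symm.monotone h1, α.symm.monotone h2,
        α.symm.monotone h3, fun h => h4 (α.symm.injective h), h5⟩, ?_⟩
      simp)

/-- The automorphism of `FI(X,K)` induced by an automorphism `α` of `X`. -/
noncomputable def hat (K : Type*) {X : Type*} [Field K] [PartialOrder X] (α : X ≃o X) :
    FI K X ≃ₐ[K] FI K X :=
  AlgEquiv.ofLinearEquiv
    { toFun := hatFun K α
      invFun := hatFun K α.symm
      map_add' := fun _ _ => rfl
      map_smul' := fun _ _ => rfl
      left_inv := fun f => ext' fun x y => by simp [hatFun, mk_apply]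
      right_inv := fun f => ext' fun x y => by simp [hatFun, mk_apply] }
    (ext' fun x y => by
      by_cases h : x = y
      · subst h
        exact (diag_apply_self (fun _ => (1 : K)) (α.symm x)).trans
          (diag_apply_self (fun _ => (1 : K)) x).symm
      · exact (diag_apply_ne (fun _ => (1 : K)) fun h' => h (α.symm.injective h')).trans
          (diag_apply_ne (fun _ => (1 : K)) h).symm)
    (fun f g => ext' fun x y => by
      have hS : ∀ z, z ≤ α.symm y → f (α.symm x) z ≠ 0 →
          z ∈ (f.finite_left (α.symm x) (α.symm y)).toFinset :=
        fun z h1 h2 => by simpa using ⟨h1, h2⟩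
      have hT : ∀ z, z ≤ y → hatFun K α f x z ≠ 0 →
          z ∈ (f.finite_left (α.symm x) (α.symm y)).toFinset.map α.toEquiv.toEmbedding := by
        intro z h1 h2
        rw [Finset.mem_map]
        exact ⟨α.symm z, hS _ (α.symm.monotone h1) h2, by simp⟩
      refine (mul_apply_of_left f g _ _ _ hS).trans
        (Eq.trans ?_ (mul_apply_of_left (hatFun K α f) (hatFun K α g) x y _ hT).symm)
      rw [Finset.sum_map]
      refine Finset.sum_congr rfl fun z _ => ?_
      simp [hatFun, mk_apply])

theorem hat_apply (α : X ≃o X) (f : FI K X) (x y : X) :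
    hat K α f x y = f (α.symm x) (α.symm y) := rfl

/-- An automorphism of `FI(X,K)` is multiplicative if it is of the form
`f ↦ ((x, y) ↦ σ x y * f x y)` for some `σ` in `I(X,K)` with `σ x y ≠ 0` for `x ≤ y` and
`σ x y * σ y z = σ x z` for `x ≤ y ≤ z`. -/
def IsMultiplicativeAut (Φ : FI K X ≃ₐ[K] FI K X) : Prop :=
  ∃ σ : IncidenceAlgebra K X, (∀ x y, x ≤ y → σ x y ≠ 0) ∧
    (∀ x y z, x ≤ y → y ≤ z → σ x y * σ y z = σ x z) ∧
    ∀ f x y, Φ f x y = σ x y * f x y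

/-- The map `ρ` on `FI(X,K)` induces the map `l` on `X`: for every `x`, the element `ρ (e_x)` is
conjugate to `e_{l x}`. -/
def InducesOnPoset (ρ : FI K X → FI K X) (l : X → X) : Prop :=
  ∀ x : X, ∃ u : (FI K X)ˣ, ρ (e K x) = u * e K (l x) * (u⁻¹ : (FI K X)ˣ)

end FI

namespace FI

variable {K X : Type*} [Field K] [PartialOrder X]

/-! ### Entries and diagonals -/

/-! The poset and the field are both recovered from the ring structure of `FI K X`.

Points of X correspond to conjugacy classes of nonzero idempotents `f` with one-dimensional corner
`f A f`. Every idempotent is conjugate to its diagonal (`isConj_diag_of_idempotent`), and a diagonal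
idempotent with such a corner is some `e_x` (`exists_isConj_e`). Distinct `e_x` are not conjugate,
since diagonal entries are conjugation invariants. The order is visible too: `x ≤ y` iff `e_x A e_y
≠ 0`. Hence an algebra automorphism induces an automorphism of X, and an involution induces an
order-reversing self-inverse map. The conjugating units exist because an element with diagonal one
is inverted by a geometric series that is finite at each entry.

For connected X the center is K, so an involution restricts to K. An equivalence `Φ` fixes K
pointwise, so both involutions have the same restriction; applied to `e_x`, the relation `Φ ∘ ρ₁ =
ρ₂ ∘ Φ` becomes an equivalence of the induced maps on X. Part (ii) is the same transport along `hat
K α`, which sends `e_x` to `e_{α x}`. -/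

theorem one_apply_self (x : X) : (1 : FI K X) x x = 1 := diag_apply_self _ x

theorem one_apply_ne {x y : X} (h : x ≠ y) : (1 : FI K X) x y = 0 := diag_apply_ne _ h

theorem sub_apply (f g : FI K X) (x y : X) : (f - g) x y = f x y - g x y := rfl

theorem algebraMap_eq_diag (k : K) : algebraMap K (FI K X) k = diag fun _ => k := by
  rw [Algebra.algebraMap_eq_smul_one]
  refine ext' fun x y => ?_
  rw [smul_apply]
  by_cases h : x = y
  · subst h
    rw [one_apply_self, diag_apply_self, mul_one]
  · rw [one_apply_ne h, diag_apply_ne _ h, mul_zero]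

theorem mul_apply_self (f g : FI K X) (x : X) : (f * g) x x = f x x * g x x := by
  rw [mul_apply_of_left f g x x {x}]
  · simp
  · intro z h1 h2
    simpa using le_antisymm h1 (f.le_of_ne h2)

theorem exists_of_mul_apply_ne {f g : FI K X} {x y : X} (h : (f * g) x y ≠ 0) :
    ∃ z, f x z ≠ 0 ∧ g z y ≠ 0 := by
  by_contra! hcon
  refine h ?_
  rw [mul_apply]
  refine finsum_mem_eq_zero_of_forall_eq_zero fun z _ => ?_
  by_cases hz : f x z = 0
  · rw [hz, zero_mul]
  · rw [hcon z hz, mul_zero]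

theorem mul_apply_congr_left {f f' : FI K X} (g : FI K X) {x y : X}
    (h : ∀ z, z ≤ y → f x z = f' x z) : (f * g) x y = (f' * g) x y := by
  rw [mul_apply, mul_apply]
  exact finsum_mem_congr rfl fun z hz => by rw [h z hz.2]

theorem mul_apply_congr_right (f : FI K X) {g g' : FI K X} {x y : X}
    (h : ∀ z, x ≤ z → g z y = g' z y) : (f * g) x y = (f * g') x y := by
  rw [mul_apply, mul_apply]
  exact finsum_mem_congr rfl fun z hz => by rw [h z hz.1]

/-! ### Elements with diagonal one are invertible -/

/-- The support of `f` off the diagonal, in the interval `[x, y]`. -/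
def offDiagSupport (f : FI K X) (x y : X) : Set (X × X) :=
  {p | x ≤ p.1 ∧ p.1 ≤ p.2 ∧ p.2 ≤ y ∧ p.1 ≠ p.2 ∧ f p.1 p.2 ≠ 0}

theorem offDiagSupport_mono (f : FI K X) {x y u v : X} (h1 : x ≤ u) (h2 : v ≤ y) :
    f.offDiagSupport u v ⊆ f.offDiagSupport x y :=
  fun _ ⟨a, b, c, d⟩ => ⟨h1.trans a, b, c.trans h2, d⟩

/-- The number of nonzero off-diagonal entries of `f` in the interval `[x, y]`. -/
noncomputable def offDiagCard (f : FI K X) (x y : X) : ℕ := (f.offDiagSupport x y).ncard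

theorem offDiagCard_mono (f : FI K X) {x y u v : X} (h1 : x ≤ u) (h2 : v ≤ y) :
    f.offDiagCard u v ≤ f.offDiagCard x y :=
  Set.ncard_le_ncard (f.offDiagSupport_mono h1 h2) (f.finite_intervals x y)

/-- Each factor moves strictly up from some `x` to some `z`. The nonzero entry `(x, z)` counts for
`[x, y]` but not for `[z, y]`, so every factor uses up at least one entry. -/
theorem le_offDiagCard_of_pow_ne {n : FI K X} (hn : ∀ x, n x x = 0) (k : ℕ) :
    ∀ x y, (n ^ k) x y ≠ 0 → k ≤ n.offDiagCard x y := by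
  induction k with
  | zero => exact fun _ _ _ => Nat.zero_le _
  | succ k ih =>
    intro x y h
    rw [pow_succ'] at h
    obtain ⟨z, h1, h2⟩ := exists_of_mul_apply_ne h
    have hxz : x ≠ z := fun e => h1 (e ▸ hn x)
    have hle := n.le_of_ne h1
    refine (Nat.succ_le_succ (ih z y h2)).trans (Nat.succ_le_of_lt ?_)
    refine Set.ncard_lt_ncard ⟨n.offDiagSupport_mono hle le_rfl, fun hsub => ?_⟩
      (n.finite_intervals x y)
    have hmem : (x, z) ∈ n.offDiagSupport x y :=
      ⟨le_rfl, hle, (n ^ k).le_of_ne h2, hxz, h1⟩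
    exact hxz (le_antisymm hle (hsub hmem).1)

/-- Off the diagonal, a nonzero entry of a power starts and ends with a nonzero entry of the
base. -/
theorem mem_of_pow_ne {n : FI K X} (k : ℕ) {x y : X} (hxy : x ≠ y) (h : (n ^ k) x y ≠ 0) :
    (∃ z, z ≤ y ∧ x ≠ z ∧ n x z ≠ 0) ∧ ∃ z, x ≤ z ∧ z ≠ y ∧ n z y ≠ 0 := by
  constructor
  · induction k with
    | zero => exact absurd (one_apply_ne hxy) (by simpa using h)
    | succ k ih =>
      rw [pow_succ'] at h
      obtain ⟨z, h1, h2⟩ := exists_of_mul_apply_ne h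
      by_cases e : x = z
      · exact ih (e ▸ h2)
      · exact ⟨z, (n ^ k).le_of_ne h2, e, h1⟩
  · induction k with
    | zero => exact absurd (one_apply_ne hxy) (by simpa using h)
    | succ k ih =>
      rw [pow_succ] at h
      obtain ⟨z, h1, h2⟩ := exists_of_mul_apply_ne h
      by_cases e : z = y
      · exact ih (e ▸ h1)
      · exact ⟨z, (n ^ k).le_of_ne h1, e, h2⟩

/-- The geometric series of an element with zero diagonal: at each pair only finitely many terms
are nonzero. -/
noncomputable def geomSeries (n : FI K X) : FI K X :=
  mk (fun x y => (∑ k ∈ Finset.range (n.offDiagCard x y + 1), n ^ k) x y)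
    (fun _ _ h => apply_eq_zero _ h)
    (by
      intro x y _
      refine (((n.finite_intervals x y).image Prod.fst).prod
        ((n.finite_intervals x y).image Prod.snd)).subset ?_
      rintro ⟨u, v⟩ ⟨h1, h2, h3, h4, h5⟩
      simp only at h1 h2 h3 h4 h5
      have key : ∃ k, (n ^ k) u v ≠ 0 := by
        by_contra! hcon
        refine h5 ?_
        generalize Finset.range (n.offDiagCard u v + 1) = S
        induction S using Finset.cons_induction with
        | empty => rfl
        | cons a S ha ih => rw [Finset.sum_cons, add_apply, hcon a, ih, add_zero]
      obtain ⟨k, hk⟩ := key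
      -- The first link `(u, z)` and the last link `(w, v)` are nonzero off-diagonal entries of `n`
      -- in `[x, y]`, which leaves finitely many choices for `u` and for `v`.
      obtain ⟨⟨z, hz1, hz2, hz3⟩, w, hw1, hw2, hw3⟩ := mem_of_pow_ne k h4 hk
      exact ⟨⟨(u, z), ⟨h1, n.le_of_ne hz3, hz1.trans h3, hz2, hz3⟩, rfl⟩,
        ⟨(w, v), ⟨h1.trans hw1, n.le_of_ne hw3, h3, hw2, hw3⟩, rfl⟩⟩)

/-- Longer truncations give the same entry. As the count is monotone in the interval, the truncation
for `[x, y]` serves every subinterval met in a product at `(x, y)`, and the finite sum telescopes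
there. -/
theorem geomSeries_apply {n : FI K X} (hn : ∀ x, n x x = 0) {x y : X} {N : ℕ}
    (hN : n.offDiagCard x y < N) :
    n.geomSeries x y = (∑ k ∈ Finset.range N, n ^ k) x y := by
  induction N, hN using Nat.le_induction with
  | base => rfl
  | succ N hN ih =>
    rw [Finset.sum_range_succ, add_apply, ← ih]
    have : (n ^ N) x y = 0 := by
      by_contra h
      have := le_offDiagCard_of_pow_ne hn N x y h
      omega
    rw [this, add_zero]

theorem one_sub_mul_geomSeries {n : FI K X} (hn : ∀ x, n x x = 0) :
    (1 - n) * n.geomSeries = 1 := by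
  refine ext' fun x y => ?_
  rw [mul_apply_congr_right (g' := ∑ k ∈ Finset.range (n.offDiagCard x y + 1), n ^ k) _
    fun z hz => geomSeries_apply hn (Nat.lt_succ_of_le (n.offDiagCard_mono hz le_rfl)),
    mul_neg_geom_sum, sub_apply]
  have : (n ^ (n.offDiagCard x y + 1)) x y = 0 := by
    by_contra h
    have := le_offDiagCard_of_pow_ne hn _ x y h
    omega
  rw [this, sub_zero]

theorem geomSeries_mul_one_sub {n : FI K X} (hn : ∀ x, n x x = 0) :
    n.geomSeries * (1 - n) = 1 := by
  refine ext' fun x y => ?_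
  rw [mul_apply_congr_left (f' := ∑ k ∈ Finset.range (n.offDiagCard x y + 1), n ^ k) _
    fun z hz => geomSeries_apply hn (Nat.lt_succ_of_le (n.offDiagCard_mono le_rfl hz)),
    geom_sum_mul_neg, sub_apply]
  have : (n ^ (n.offDiagCard x y + 1)) x y = 0 := by
    by_contra h
    have := le_offDiagCard_of_pow_ne hn _ x y h
    omega
  rw [this, sub_zero]

theorem isUnit_of_diag_eq_one {f : FI K X} (hf : ∀ x, f x x = 1) : IsUnit f := by
  have hn : ∀ x, (1 - f) x x = 0 := fun x => by rw [sub_apply, one_apply_self, hf, sub_self]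
  refine ⟨⟨f, (1 - f).geomSeries, ?_, ?_⟩, rfl⟩
  · simpa using one_sub_mul_geomSeries hn
  · simpa using geomSeries_mul_one_sub hn

/-! ### Idempotents -/

/-- With `g` the diagonal of `f`, also idempotent, the element `u = g f + (1 - g)(1 - f)` satisfies
`u f = g f = g u`. It is a unit because its diagonal entries are `d² + (1 - d)² = 1` for `d² = d`.
-/
theorem isConj_diag_of_idempotent {f : FI K X} (hf : f * f = f) :
    IsConj (diag fun x => f x x) f := by
  have hd : ∀ x, f x x * f x x = f x x := fun x => by rw [← mul_apply_self, hf]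
  set g : FI K X := diag fun x => f x x with hg
  have hgg : g * g = g := ext' fun x y => by
    rw [hg, diag_mul_apply]
    by_cases h : x = y
    · subst h
      rw [diag_apply_self, hd]
    · rw [diag_apply_ne _ h, mul_zero]
  have hu : IsUnit (g * f + (1 - g) * (1 - f)) := isUnit_of_diag_eq_one fun x => by
    rw [add_apply, mul_apply_self, mul_apply_self, sub_apply, sub_apply, one_apply_self, hg,
      diag_apply_self]
    linear_combination 2 * hd x
  obtain ⟨u, hu⟩ := hu
  refine IsConj.symm ⟨u, ?_⟩
  rw [SemiconjBy, hu]
  have h1 : (1 - f) * f = 0 := by rw [sub_mul, one_mul, hf, sub_self]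
  have h2 : g * (1 - g) = 0 := by rw [mul_sub, mul_one, hgg, sub_self]
  rw [add_mul, mul_add, mul_assoc, mul_assoc, h1, hf, ← mul_assoc, hgg, ← mul_assoc, h2]
  simp

theorem e_apply_self (x : X) : e K x x x = 1 := by
  rw [e, diag_apply_self, if_pos rfl]

theorem e_apply_ne {x y : X} (h : y ≠ x) : e K x y y = 0 := by
  rw [e, diag_apply_self, if_neg h]

theorem e_ne_zero (x : X) : e K x ≠ 0 := fun h => by
  have := e_apply_self (K := K) x
  rw [h, zero_apply] at this
  exact zero_ne_one this

theorem e_mul_mul_e_apply (a : FI K X) (x y : X) : (e K x * a * e K y) x y = a x y := by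
  rw [e, e, mul_diag_apply, diag_mul_apply, if_pos rfl, if_pos rfl, one_mul, mul_one]

theorem e_mul_mul_e_apply_ne (a : FI K X) {x y u v : X} (h : ¬ (u = x ∧ v = y)) :
    (e K x * a * e K y) u v = 0 := by
  rw [e, e, mul_diag_apply, diag_mul_apply]
  by_cases hu : u = x
  · rw [if_neg fun hv => h ⟨hu, hv⟩, mul_zero]
  · rw [if_neg hu, zero_mul, zero_mul]

theorem e_mul_self (x : X) : e K x * e K x = e K x := ext' fun u v => by
  rw [e, diag_mul_apply]
  by_cases h : u = x
  · rw [if_pos h, one_mul]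
  · rw [if_neg h, zero_mul]
    by_cases huv : u = v
    · subst huv
      rw [diag_apply_self, if_neg h]
    · rw [diag_apply_ne _ huv]

theorem e_mul_mul_e_self (a : FI K X) (x : X) : e K x * a * e K x = a x x • e K x := by
  refine ext' fun u v => ?_
  by_cases h : u = x ∧ v = x
  · obtain ⟨rfl, rfl⟩ := h
    rw [e_mul_mul_e_apply, smul_apply, e_apply_self, mul_one]
  · rw [e_mul_mul_e_apply_ne a h, smul_apply]
    by_cases huv : u = v
    · subst huv
      rw [e_apply_ne fun h' => h ⟨h', h'⟩, mul_zero]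
    · rw [e, diag_apply_ne _ huv, mul_zero]

/-- The element with entry `1` at `(x, y)` and `0` elsewhere. -/
noncomputable def single (K : Type*) {X : Type*} [Field K] [PartialOrder X] {x y : X}
    (hxy : x ≤ y) : FI K X :=
  mk (open Classical in fun u v => if u = x ∧ v = y then 1 else 0)
    (by
      rintro u v h
      exact if_neg fun ⟨h1, h2⟩ => h (h1 ▸ h2 ▸ hxy))
    (by
      intro u v _
      refine (Set.finite_singleton (x, y)).subset ?_
      rintro ⟨a, b⟩ ⟨-, -, -, -, h⟩
      by_contra hne
      exact h (if_neg fun ⟨h1, h2⟩ => hne (by simp_all)))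

theorem single_apply_self {x y : X} (hxy : x ≤ y) : single K hxy x y = 1 := if_pos ⟨rfl, rfl⟩

/-- This puts the order in ring-theoretic terms, which automorphisms preserve and involutions
reverse. -/
theorem le_iff_exists_e_mul_mul_e_ne (x y : X) :
    x ≤ y ↔ ∃ a : FI K X, e K x * a * e K y ≠ 0 := by
  constructor
  · intro h
    refine ⟨single K h, fun h0 => ?_⟩
    have := e_mul_mul_e_apply (single K h) x y
    rw [h0, zero_apply, single_apply_self] at this
    exact zero_ne_one this
  · rintro ⟨a, ha⟩
    by_contra h
    refine ha (ext' fun u v => ?_)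
    by_cases huv : u = x ∧ v = y
    · obtain ⟨rfl, rfl⟩ := huv
      exact apply_eq_zero _ h
    · exact e_mul_mul_e_apply_ne a huv

/-- Taking the `(x, x)` entry is multiplicative with values in a commutative field, so conjugation
cancels. -/
theorem apply_self_eq_of_isConj {f g : FI K X} (h : IsConj f g) (x : X) : f x x = g x x := by
  obtain ⟨u, hu⟩ := h
  have h1 : (u : FI K X) x x * f x x = g x x * (u : FI K X) x x := by
    rw [← mul_apply_self, ← mul_apply_self, hu.eq]
  have h2 : (u : FI K X) x x ≠ 0 := fun h0 => by
    have := mul_apply_self (u : FI K X) ((u⁻¹ : (FI K X)ˣ) : FI K X) x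
    rw [Units.mul_inv, one_apply_self, h0, zero_mul] at this
    exact one_ne_zero this
  exact mul_left_cancel₀ h2 (h1.trans (mul_comm _ _))

theorem eq_of_isConj_e {x y : X} (h : IsConj (e K x) (e K y)) : x = y := by
  by_contra hne
  have := apply_self_eq_of_isConj h x
  rw [e_apply_self, e_apply_ne hne] at this
  exact one_ne_zero this

/-- A nonzero idempotent `f` whose corner `f A f` is one-dimensional is conjugate to some
`e_x`. -/
theorem exists_isConj_e {f : FI K X} (hf : f * f = f) (h0 : f ≠ 0)
    (hK : ∀ a, ∃ c : K, f * a * f = c • f) : ∃ x, IsConj (e K x) f := by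
  have hconj := isConj_diag_of_idempotent hf
  obtain ⟨u, hu⟩ := hconj
  have hd : ∀ x, f x x * f x x = f x x := fun x => by rw [← mul_apply_self, hf]
  set g : FI K X := diag fun x => f x x with hg
  have hfg : f = u * g * (u⁻¹ : (FI K X)ˣ) := by rw [hu.eq, Units.mul_inv_cancel_right]
  have hgf : g = (u⁻¹ : (FI K X)ˣ) * f * u := by
    rw [mul_assoc, ← hu.eq, Units.inv_mul_cancel_left]
  -- The corner condition is invariant under conjugation, so it passes to the diagonal `g`.
  have hgK : ∀ a, ∃ c : K, g * a * g = c • g := fun a => by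
    obtain ⟨c, hc⟩ := hK (u * a * (u⁻¹ : (FI K X)ˣ))
    refine ⟨c, ?_⟩
    calc g * a * g = (u⁻¹ : (FI K X)ˣ) * (f * (u * a * (u⁻¹ : (FI K X)ˣ)) * f) * u := by
          rw [hgf]; simp only [mul_assoc]
      _ = c • g := by rw [hc, hgf, mul_smul_comm, smul_mul_assoc]
  obtain ⟨x, hx⟩ : ∃ x, f x x ≠ 0 := by
    by_contra! hcon
    have : g = 0 := ext' fun u v => by
      rw [hg, zero_apply]
      by_cases huv : u = v
      · subst huv
        rw [diag_apply_self, hcon]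
      · exact diag_apply_ne _ huv
    exact h0 (by rw [hfg, this, mul_zero, zero_mul])
  have hx1 : f x x = 1 := mul_left_cancel₀ hx (by rw [hd, mul_one])
  -- Testing the corner on `e_x` isolates `x`: the `(x, x)` entry of `g e_x g = c g` forces `c = 1`,
  -- and then the other diagonal entries of `g` vanish.
  obtain ⟨c, hc⟩ := hgK (e K x)
  have hcy : ∀ y, f y y * e K x y y * f y y = c * f y y := fun y => by
    have := congrArg (fun a : FI K X => a y y) hc
    simpa only [hg, smul_apply, mul_apply_self, diag_apply_self] using this
  have hc1 : c = 1 := by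
    have := hcy x
    rw [e_apply_self, hx1] at this
    linear_combination -this
  have hge : g = e K x := by
    rw [hg, e]
    congr 1
    funext y
    split_ifs with h
    · rw [h, hx1]
    · have := hcy y
      rw [e_apply_ne h, hc1] at this
      linear_combination -this
  exact ⟨x, hge ▸ ⟨u, hu⟩⟩

/-! ### The center -/

/-- Commuting with each `e_x` makes `c` diagonal; commuting with the matrix unit at `(x, y)` equates
its entries at `x ≤ y`. Connectedness then makes the diagonal constant. -/
theorem exists_algebraMap_of_mem_center (hconn : IsConnectedPoset X) {c : FI K X}
    (hc : c ∈ Subring.center (FI K X)) : ∃ k : K, c = algebraMap K (FI K X) k := by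
  rw [Subring.mem_center_iff] at hc
  have hoff : ∀ x y, x ≠ y → c x y = 0 := fun x y h => by
    have := congrArg (fun a : FI K X => a x y) (hc (e K x))
    simpa only [e, diag_mul_apply, mul_diag_apply, if_true, if_neg h.symm, one_mul,
      mul_zero] using this
  have hdiag : c = diag fun x => c x x := ext' fun x y => by
    by_cases h : x = y
    · subst h
      rw [diag_apply_self]
    · rw [diag_apply_ne _ h, hoff x y h]
  have hle : ∀ x y, x ≤ y → c x x = c y y := fun x y h => by
    have := congrArg (fun a : FI K X => a x y) (hc (single K h))
    rw [hdiag] at this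
    simp only [diag_mul_apply, mul_diag_apply, single_apply_self, one_mul, mul_one] at this
    exact this.symm
  have hall : ∀ x y, c x x = c y y := fun x y => by
    induction hconn x y with
    | single h => exact h.elim (hle _ _) fun h => (hle _ _ h).symm
    | tail _ h ih => exact ih.trans (h.elim (hle _ _) fun h => (hle _ _ h).symm)
  rcases isEmpty_or_nonempty X with hX | ⟨⟨x₀⟩⟩
  · exact ⟨0, ext' fun x => hX.elim x⟩
  · exact ⟨c x₀ x₀, by rw [algebraMap_eq_diag, hdiag]; simp only [diag_apply_self, hall _ x₀]⟩

theorem algebraMap_injective' [Nonempty X] : Function.Injective (algebraMap K (FI K X)) := by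
  intro a b h
  obtain ⟨x⟩ := ‹Nonempty X›
  rw [algebraMap_eq_diag, algebraMap_eq_diag] at h
  have := congrArg (fun f : FI K X => f x x) h
  simpa only [diag_apply_self] using this

theorem inducesOnPoset_iff (ρ : FI K X → FI K X) (l : X → X) :
    InducesOnPoset ρ l ↔ ∀ x, IsConj (e K (l x)) (ρ (e K x)) := by
  refine forall_congr' fun x => exists_congr fun u => ?_
  rw [SemiconjBy, Units.eq_mul_inv_iff_mul_eq, eq_comm]

end FI

/-! ### Involutions of the finitary incidence algebra -/

namespace IsInvolution

theorem map_one {A : Type*} [Ring A] {ρ : A → A} (h : IsInvolution ρ) : ρ 1 = 1 := by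
  have := h.map_mul (ρ 1) 1
  rwa [mul_one, h.involutive, mul_one, eq_comm] at this

theorem map_zero {A : Type*} [Ring A] {ρ : A → A} (h : IsInvolution ρ) : ρ 0 = 0 := by
  simpa using h.map_add 0 0

theorem map_ne_zero {A : Type*} [Ring A] {ρ : A → A} (h : IsInvolution ρ) {a : A}
    (ha : a ≠ 0) : ρ a ≠ 0 :=
  fun h0 => ha (by rw [← h.involutive a, h0, h.map_zero])

theorem map_mem_center {A : Type*} [Ring A] {ρ : A → A} (h : IsInvolution ρ) {a : A}
    (ha : a ∈ Subring.center A) : ρ a ∈ Subring.center A := by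
  rw [Subring.mem_center_iff] at ha ⊢
  intro b
  rw [← h.involutive b, ← h.map_mul, ← h.map_mul, ha]

-- Products are reversed, so `ρ u` conjugates `ρ b` to `ρ a`; symmetry of conjugacy restores the
-- direction.
theorem map_isConj {A : Type*} [Ring A] {ρ : A → A} (h : IsInvolution ρ) {a b : A}
    (hab : IsConj a b) : IsConj (ρ a) (ρ b) := by
  obtain ⟨u, hu⟩ := hab
  let v : Aˣ := ⟨ρ u, ρ (u⁻¹ : Aˣ), by rw [← h.map_mul, Units.inv_mul, h.map_one],
    by rw [← h.map_mul, Units.mul_inv, h.map_one]⟩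
  refine IsConj.symm ⟨v, ?_⟩
  change ρ u * ρ b = ρ a * ρ u
  rw [← h.map_mul, ← h.map_mul, hu.eq]

variable {K X : Type*} [Field K] [PartialOrder X] {ρ : FI K X → FI K X}

theorem exists_inducesOnField (h : IsInvolution ρ) (hconn : IsConnectedPoset X) :
    ∃ s : K → K, InducesOnField ρ s := by
  have (k : K) : ∃ k' : K, ρ (algebraMap K (FI K X) k) = algebraMap K (FI K X) k' :=
    FI.exists_algebraMap_of_mem_center hconn (h.map_mem_center (by
      rw [Subring.mem_center_iff]
      exact fun g => (Algebra.commutes k g).symm))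
  choose s hs using this
  exact ⟨s, hs⟩

theorem of_inducesOnField [Nonempty X] (h : IsInvolution ρ) {s : K → K}
    (hs : InducesOnField ρ s) : IsInvolution s where
  map_add a b := FI.algebraMap_injective' (X := X) (by
    rw [← hs, _root_.map_add, h.map_add, hs, hs, _root_.map_add])
  map_mul a b := FI.algebraMap_injective' (X := X) (by
    rw [← hs, _root_.map_mul, h.map_mul, hs, hs, _root_.map_mul])
  involutive a := FI.algebraMap_injective' (X := X) (by rw [← hs, ← hs, h.involutive])

theorem exists_inducesOnPoset (h : IsInvolution ρ) (hconn : IsConnectedPoset X) :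
    ∃ l : X → X, ∀ x, IsConj (FI.e K (l x)) (ρ (FI.e K x)) := by
  obtain ⟨s, hs⟩ := h.exists_inducesOnField hconn
  have (x : X) : ∃ y, IsConj (FI.e K y) (ρ (FI.e K x)) := by
    refine FI.exists_isConj_e (by rw [← h.map_mul, FI.e_mul_self])
      -- The corner of `ρ (e_x)` is the image of the corner of `e_x`. As `ρ` is only semilinear, the
      -- scalar `ρ a x x` comes out twisted by `s`.
      (h.map_ne_zero (FI.e_ne_zero x)) fun a => ⟨s (ρ a x x), ?_⟩
    calc ρ (FI.e K x) * a * ρ (FI.e K x) = ρ (FI.e K x * ρ a * FI.e K x) := by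
          rw [h.map_mul, h.map_mul, h.involutive, mul_assoc]
      _ = _ := by
          rw [FI.e_mul_mul_e_self, Algebra.smul_def, h.map_mul, hs, Algebra.smul_def,
            Algebra.commutes]
  choose l hl using this
  exact ⟨l, hl⟩

theorem isPosetInvolution (h : IsInvolution ρ) {l : X → X}
    (hl : ∀ x, IsConj (FI.e K (l x)) (ρ (FI.e K x))) : IsPosetInvolution l := by
  have hinv : ∀ x, l (l x) = x := fun x => FI.eq_of_isConj_e (K := K) (by
    have := h.map_isConj (hl x)
    rw [h.involutive] at this
    exact (hl (l x)).trans this)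
  have hle : ∀ x y, x ≤ y → l y ≤ l x := by
    intro x y hxy
    obtain ⟨a, ha⟩ := (FI.le_iff_exists_e_mul_mul_e_ne (K := K) x y).mp hxy
    obtain ⟨u, hu⟩ := hl x
    obtain ⟨v, hv⟩ := hl y
    have hu' : ρ (FI.e K x) = u * FI.e K (l x) * (u⁻¹ : (FI K X)ˣ) := by
      rw [hu.eq, Units.mul_inv_cancel_right]
    have hv' : ρ (FI.e K y) = v * FI.e K (l y) * (v⁻¹ : (FI K X)ˣ) := by
      rw [hv.eq, Units.mul_inv_cancel_right]
    -- Applying `ρ` to `e_x a e_y ≠ 0` gives `ρ(e_y) ρ(a) ρ(e_x) ≠ 0`; the witness absorbs the inner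
    -- conjugating units, and the outer ones do not affect vanishing.
    refine (FI.le_iff_exists_e_mul_mul_e_ne (K := K) _ _).mpr
      ⟨(v⁻¹ : (FI K X)ˣ) * ρ a * u, fun h0 => h.map_ne_zero ha ?_⟩
    rw [h.map_mul, h.map_mul, hu', hv']
    calc _ = v * (FI.e K (l y) * ((v⁻¹ : (FI K X)ˣ) * ρ a * u) * FI.e K (l x)) *
          (u⁻¹ : (FI K X)ˣ) := by simp only [mul_assoc]
      _ = 0 := by rw [h0, mul_zero, zero_mul]
  refine ⟨hinv, fun x y => ⟨hle x y, fun h' => ?_⟩⟩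
  have := hle _ _ h'
  rwa [hinv, hinv] at this

end IsInvolution

/-! ### Algebra automorphisms and the poset automorphisms they induce -/

namespace FI

variable {K X : Type*} [Field K] [PartialOrder X]

theorem eq_iff_of_isConj {ρ : FI K X → FI K X} {l : X → X}
    (hl : ∀ x, IsConj (e K (l x)) (ρ (e K x))) (l' : X → X) : InducesOnPoset ρ l' ↔ l' = l := by
  rw [inducesOnPoset_iff]
  constructor
  · exact fun h => funext fun x => eq_of_isConj_e ((h x).trans (hl x).symm)
  · rintro rfl
    exact hl

theorem exists_map_isConj (Φ : FI K X ≃ₐ[K] FI K X) :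
    ∃ a : X → X, ∀ x, IsConj (e K (a x)) (Φ (e K x)) := by
  have (x : X) : ∃ y, IsConj (e K y) (Φ (e K x)) := by
    refine exists_isConj_e (by rw [← map_mul, e_mul_self])
      (by simpa using e_ne_zero x) fun a => ⟨Φ.symm a x x, ?_⟩
    rw [← map_smul, ← e_mul_mul_e_self, map_mul, map_mul, AlgEquiv.apply_symm_apply]
  choose a ha using this
  exact ⟨a, ha⟩

theorem map_isConj (Φ : FI K X ≃ₐ[K] FI K X) {f g : FI K X} (h : IsConj f g) :
    IsConj (Φ f) (Φ g) := MonoidHom.map_isConj (Φ : FI K X →* FI K X) h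

theorem le_of_isConj (Φ : FI K X ≃ₐ[K] FI K X) {a : X → X}
    (ha : ∀ x, IsConj (e K (a x)) (Φ (e K x))) {x y : X} (hxy : x ≤ y) : a x ≤ a y := by
  obtain ⟨b, hb⟩ := (le_iff_exists_e_mul_mul_e_ne (K := K) x y).mp hxy
  obtain ⟨u, hu⟩ := ha x
  obtain ⟨v, hv⟩ := ha y
  have hu' : Φ (e K x) = u * e K (a x) * (u⁻¹ : (FI K X)ˣ) := by
    rw [hu.eq, Units.mul_inv_cancel_right]
  have hv' : Φ (e K y) = v * e K (a y) * (v⁻¹ : (FI K X)ˣ) := by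
    rw [hv.eq, Units.mul_inv_cancel_right]
  refine (le_iff_exists_e_mul_mul_e_ne (K := K) _ _).mpr
    ⟨(u⁻¹ : (FI K X)ˣ) * Φ b * v, fun h0 => hb (Φ.injective ?_)⟩
  rw [map_zero, map_mul, map_mul, hu', hv']
  calc _ = u * (e K (a x) * ((u⁻¹ : (FI K X)ˣ) * Φ b * v) * e K (a y)) *
        (v⁻¹ : (FI K X)ˣ) := by simp only [mul_assoc]
    _ = 0 := by rw [h0, mul_zero, zero_mul]

/-- Every `K`-algebra automorphism permutes the conjugacy classes of the `e_x` through an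
automorphism of the poset. -/
theorem exists_orderIso_isConj (Φ : FI K X ≃ₐ[K] FI K X) :
    ∃ α : X ≃o X, ∀ x, IsConj (e K (α x)) (Φ (e K x)) := by
  obtain ⟨a, ha⟩ := exists_map_isConj Φ
  obtain ⟨b, hb⟩ := exists_map_isConj Φ.symm
  have hab : ∀ x, a (b x) = x := fun x => eq_of_isConj_e (K := K) (by
    have := map_isConj Φ (hb x)
    rw [AlgEquiv.apply_symm_apply] at this
    exact (ha (b x)).trans this)
  have hba : ∀ x, b (a x) = x := fun x => eq_of_isConj_e (K := K) (by
    have := map_isConj Φ.symm (ha x)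
    rw [AlgEquiv.symm_apply_apply] at this
    exact (hb (a x)).trans this)
  refine ⟨⟨⟨a, b, hba, hab⟩, fun {x y} => ⟨fun h => ?_, le_of_isConj Φ ha⟩⟩, ha⟩
  have := le_of_isConj Φ.symm hb h
  simpa only [Equiv.coe_fn_mk, hba] using this

theorem hat_e (α : X ≃o X) (x : X) : hat K α (e K x) = e K (α x) := by
  refine ext' fun u v => ?_
  rw [hat_apply]
  by_cases h : u = v
  · subst h
    rw [e, e, diag_apply_self, diag_apply_self]
    by_cases hu : u = α x
    · rw [if_pos (α.symm_apply_eq.mpr hu), if_pos hu]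
    · rw [if_neg fun h' => hu (α.symm_apply_eq.mp h'), if_neg hu]
  · rw [e, e, diag_apply_ne _ h, diag_apply_ne _ fun h' => h (α.symm.injective h')]

/-- The one element `Φ (ρ₁ (e_x)) = ρ₂ (Φ (e_x))` is conjugate both to the idempotent at `α (l₁ x)`
and to that at `l₂ (α x)`, so these points agree. -/
theorem equivalentPosetInvolutions_of_isConj {ρ₁ ρ₂ : FI K X → FI K X} (h₂ : IsInvolution ρ₂)
    (hequiv : EquivalentInvolutions K ρ₁ ρ₂) {l₁ l₂ : X → X}
    (hl₁ : ∀ x, IsConj (e K (l₁ x)) (ρ₁ (e K x)))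
    (hl₂ : ∀ x, IsConj (e K (l₂ x)) (ρ₂ (e K x))) : EquivalentPosetInvolutions l₁ l₂ := by
  obtain ⟨Φ, hΦ⟩ := hequiv
  obtain ⟨α, hα⟩ := exists_orderIso_isConj Φ
  refine ⟨α, funext fun x => eq_of_isConj_e (K := K) ?_⟩
  have h1 : IsConj (e K (α (l₁ x))) (Φ (ρ₁ (e K x))) := (hα _).trans (map_isConj Φ (hl₁ x))
  have h2 : IsConj (e K (l₂ (α x))) (ρ₂ (Φ (e K x))) := (hl₂ _).trans (h₂.map_isConj (hα x))
  rw [show Φ (ρ₁ (e K x)) = ρ₂ (Φ (e K x)) from congrFun hΦ (e K x)] at h1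
  exact h1.trans h2.symm

end FI

/-! ### Restriction to the field, and conjugation of involutions -/

theorem InducesOnField.of_equivalent {K A : Type*} [Field K] [Ring A] [Algebra K A]
    {ρ₁ ρ₂ : A → A} (hequiv : EquivalentInvolutions K ρ₁ ρ₂) {s : K → K}
    (hs : InducesOnField ρ₁ s) : InducesOnField ρ₂ s := by
  obtain ⟨Φ, hΦ⟩ := hequiv
  intro k
  have := congrFun hΦ (algebraMap K A k)
  simp only [Function.comp_apply, hs k, AlgEquiv.commutes] at this
  exact this.symm

theorem IsInvolution.conj {K A : Type*} [Field K] [Ring A] [Algebra K A] {ρ : A → A}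
    (h : IsInvolution ρ) (Φ : A ≃ₐ[K] A) : IsInvolution (⇑Φ ∘ ρ ∘ ⇑Φ.symm) where
  map_add a b := by simp [h.map_add]
  map_mul a b := by simp [h.map_mul]
  involutive a := by simp [h.involutive]

theorem equivalentInvolutions_conj {K A : Type*} [Field K] [Ring A] [Algebra K A] (ρ : A → A)
    (Φ : A ≃ₐ[K] A) : EquivalentInvolutions K ρ (⇑Φ ∘ ρ ∘ ⇑Φ.symm) :=
  ⟨Φ, funext fun a => by simp⟩

theorem IsInvolutionOfSecondKind.of_inducesOnField {K X : Type*} [Field K] [PartialOrder X]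
    (hconn : IsConnectedPoset X) {ρ : FI K X → FI K X} (h : IsInvolutionOfSecondKind ρ)
    {s : K → K} (hs : InducesOnField ρ s) : IsInvolutionOfSecondKind s := by
  obtain ⟨hρ, a, ha, hne⟩ := h
  -- For empty X the algebra is zero and no central element can be moved; a point is needed to embed
  -- K.
  have : Nonempty X := by
    by_contra hX
    rw [not_nonempty_iff] at hX
    exact hne (FI.ext' fun x => hX.elim x)
  obtain ⟨k, rfl⟩ := FI.exists_algebraMap_of_mem_center hconn ha
  refine ⟨hρ.of_inducesOnField hs, k, ?_, fun hk => hne (by rw [hs, hk])⟩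
  rw [Subring.mem_center_iff]
  exact fun g => mul_comm g k

theorem corollary4p14 {K X : Type*} [Field K] [PartialOrder X]
    (hchar : ringChar K ≠ 2) (hconn : IsConnectedPoset X)
    (hinner : ∀ Φ : FI K X ≃ₐ[K] FI K X, FI.IsMultiplicativeAut Φ → IsInnerAut Φ) :
    (∀ ρ₁ ρ₂ : FI K X → FI K X,
      IsInvolutionOfSecondKind ρ₁ → IsInvolutionOfSecondKind ρ₂ →
      EquivalentInvolutions K ρ₁ ρ₂ →
      (∃ l₁ l₂ : X → X, IsPosetInvolution l₁ ∧ IsPosetInvolution l₂ ∧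
        (∀ l : X → X, FI.InducesOnPoset ρ₁ l ↔ l = l₁) ∧
        (∀ l : X → X, FI.InducesOnPoset ρ₂ l ↔ l = l₂) ∧
        EquivalentPosetInvolutions l₁ l₂) ∧
      (∃ s : K → K, IsInvolutionOfSecondKind s ∧
        InducesOnField ρ₁ s ∧ InducesOnField ρ₂ s)) ∧
    (∀ (l₁ l₂ : X → X) (α : X ≃o X) (s : K → K) (ρ : FI K X → FI K X),
      IsPosetInvolution l₁ → IsPosetInvolution l₂ → ⇑α ∘ l₂ = l₁ ∘ ⇑α →
      IsInvolutionOfSecondKind s →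
      IsInvolution ρ → FI.InducesOnPoset ρ l₂ → InducesOnField ρ s →
      IsInvolution (⇑(FI.hat K α) ∘ ρ ∘ ⇑(FI.hat K α).symm) ∧
      EquivalentInvolutions K ρ (⇑(FI.hat K α) ∘ ρ ∘ ⇑(FI.hat K α).symm) ∧
      FI.InducesOnPoset (⇑(FI.hat K α) ∘ ρ ∘ ⇑(FI.hat K α).symm) l₁ ∧
      InducesOnField (⇑(FI.hat K α) ∘ ρ ∘ ⇑(FI.hat K α).symm) s) := by
  refine ⟨fun ρ₁ ρ₂ h₁ h₂ hequiv => ⟨?_, ?_⟩, ?_⟩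
  · obtain ⟨l₁, hl₁⟩ := h₁.1.exists_inducesOnPoset hconn
    obtain ⟨l₂, hl₂⟩ := h₂.1.exists_inducesOnPoset hconn
    exact ⟨l₁, l₂, h₁.1.isPosetInvolution hl₁, h₂.1.isPosetInvolution hl₂,
      FI.eq_iff_of_isConj hl₁, FI.eq_iff_of_isConj hl₂,
      FI.equivalentPosetInvolutions_of_isConj h₂.1 hequiv hl₁ hl₂⟩
  · obtain ⟨s, hs⟩ := h₁.1.exists_inducesOnField hconn
    exact ⟨s, h₁.of_inducesOnField hconn hs, hs, hs.of_equivalent hequiv⟩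
  · intro l₁ l₂ α s ρ _ _ hα _ hρ hl hs
    have hequiv := equivalentInvolutions_conj ρ (FI.hat K α)
    refine ⟨hρ.conj _, hequiv, ?_, hs.of_equivalent hequiv⟩
    rw [FI.inducesOnPoset_iff] at hl ⊢
    intro x
    have hx : (FI.hat K α).symm (FI.e K x) = FI.e K (α.symm x) := by
      rw [AlgEquiv.symm_apply_eq, FI.hat_e, OrderIso.apply_symm_apply]
    -- Up to conjugacy the composite sends `e_x` through `α⁻¹ x` and `l₂ (α⁻¹ x)` to this point.
    have hlx : l₁ x = α (l₂ (α.symm x)) := by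
      simpa using (congrFun hα (α.symm x)).symm
    have := FI.map_isConj (FI.hat K α) (hl (α.symm x))
    rw [FI.hat_e, ← hlx] at this
    simpa only [Function.comp_apply, hx] using this
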